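/- Let $\mathcal S,\mathcal A$ be nonempty finite sets and $n\ge 1$. Let $\rho$ be any probability distribution on $\mathcal S$ and let $\pi^\star$ assign to every $s\in\mathcal S$ any probability distribution $\pi^\star(\cdot\mid s)$ on $\mathcal A$. Let $\mathcal D=\{(s_i,a_i)\}_{i=1}^n$ consist of i.i.d. pairs with $s_i\sim\rho$ and $a_i\sim\pi^\star(\cdot\mid s_i)$, and let the values $\pi^\star(a_i\mid s_i)$, $i=1,\dots,n$, be observed as well. Let $\hat\pi$ be any (possibly randomized) student that almost surely minimizes the empirical squared error logit loss $$\pi\mapsto\sum_{i=1}^n\tfrac12\bigl[\log\pi(a_i\mid s_i)-\log\pi^\star(a_i\mid s_i)\bigr]^2\qquad(\log 0=-\infty)$$ over all conditional distributions $\pi(\cdot\mid\cdot)$ on $\mathcal A$ given $\mathcal S$. Write $\mathsf{TV}(p,q)=\frac12\|p-q\|_1$ and $\mathsf{TV}(\hat\pi,\pi^\star\mid\rho)=\sum_{s\in\mathcal S}\rho(s)\,\mathsf{TV}(\hat\pi(\cdot\mid s),\pi^\star(\cdot\mid s))$. There is a universal constant $C>0$, independent of $\mathcal S,\mathcal A,n,\rho,\pi^\star,\hat\pi,\delta$,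 such that the following hold. 1. If $|\mathcal S|>1$, then for every $\delta\in\bigl(0,\min(1,\tfrac{|\mathcal S|+2}{10})\bigr)$, with probability at least $1-\delta$, $$\mathsf{TV}(\hat\pi,\pi^\star\mid\rho)\le C\,\frac{|\mathcal S|\bigl(|\mathcal A|+\sqrt{|\mathcal A|\log(|\mathcal S|/\delta)}\bigr)}{n}\log\frac{|\mathcal S|}{\delta}.$$ 2. If $|\mathcal S|=1$, then $\mathsf{TV}(\hat\pi,\pi^\star\mid\rho)=\mathsf{TV}(\hat\pi(\cdot\mid s),\pi^\star(\cdot\mid s))$ for the only $s\in\mathcal S$, and for every $\delta\in(0,\tfrac1{10}]$, with probability at least $1-\delta$, $$\mathsf{TV}(\hat\pi,\pi^\star\mid\rho)\le C\left(\frac{|\mathcal A|}{n}+\frac{\sqrt{|\mathcal A|}}{n}\log\frac1\delta\right).$$ 3. The expected risk satisfies $\mathbb E\,\mathsf{TV}(\hat\pi,\pi^\star\mid\rho)\le C\,\dfrac{|\mathcal S||\mathcal A|}{n}$. 4. This expected rate is not polynomially tighter than the bounds in 1 and 2. For all $\delta$ in the respective ranges, if $|\mathcal S|>1$, $$\frac{|\mathcal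 S|\bigl(|\mathcal A|+\sqrt{|\mathcal A|\log(|\mathcal S|/\delta)}\bigr)}{n}\log\frac{|\mathcal S|}{\delta}\le C\,\frac{|\mathcal S||\mathcal A|}{n}\log^2\frac{|\mathcal S|}{\delta},$$ and if $|\mathcal S|=1$, $$\frac{|\mathcal A|}{n}+\frac{\sqrt{|\mathcal A|}}{n}\log\frac1\delta\le C\,\frac{|\mathcal A|}{n}\log\frac1\delta.$$ -/

import Mathlib

open MeasureTheory ProbabilityTheory
open scoped ENNReal

/-- A conditional distribution over the labels `A` given an input in `S`: an element of the set
`Δ(A | S)` of all maps from `S` to the probability simplex over `A`. -/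
abbrev CondDist (S A : Type*) := S → PMF A

/-- The joint distribution `ρ × π` of an input-label pair: `s ∼ ρ`, then `a ∼ π(· | s)`. -/
noncomputable def jointLaw {S A : Type*} (ρ : PMF S) (π : CondDist S A) : PMF (S × A) :=
  ρ.bind fun s => (π s).map fun a => (s, a)

/-- The law `(ρ × π)ⁿ` of a dataset of `n` i.i.d. input-label pairs. -/
noncomputable def datasetLaw {S A : Type*} [MeasurableSpace S] [MeasurableSpace A]
    (ρ : PMF S) (π : CondDist S A) (n : ℕ) : Measure (Fin n → S × A) :=
  Measure.pi fun _ => (jointLaw ρ π).toMeasure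

/-- The total variation `(1/2) ‖p - q‖₁` between two distributions on a finite set. -/
noncomputable def tvDist {A : Type*} [Fintype A] (p q : PMF A) : ℝ :=
  (1 / 2) * ∑ a, |(p a).toReal - (q a).toReal|

/-- The total variation between two conditional distributions, averaged over `s ∼ ρ`. -/
noncomputable def condTV {S A : Type*} [Fintype S] [Fintype A]
    (ρ : PMF S) (π π' : CondDist S A) : ℝ :=
  ∑ s, (ρ s).toReal * tvDist (π s) (π' s)

/-- The partial soft labels: the teacher's probabilities of the sampled labels. -/
def softLabels {S A : Type*} {n : ℕ} (πstar : CondDist S A) (D : Fin n → S × A) :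
    Fin n → ℝ≥0∞ :=
  fun i => πstar (D i).1 (D i).2

/-- The empirical squared error logit loss of a student `π` on the pairs `D` with the partial
soft labels `R`. It is extended-valued, with `log 0 = -∞`, so that a student which gives
probability `0` to a sampled label has loss `+∞`. -/
noncomputable def empSEL {S A : Type*} {n : ℕ} (D : Fin n → S × A) (R : Fin n → ℝ≥0∞)
    (π : CondDist S A) : EReal :=
  ∑ i, ((1 / 2 : ℝ) : EReal) * (ENNReal.log (π (D i).1 (D i).2) - ENNReal.log (R i)) ^ 2

/-- `π` minimizes the empirical squared error logit loss over all of `Δ(A | S)`. -/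
def IsEmpSELMinimizer {S A : Type*} {n : ℕ} (D : Fin n → S × A) (R : Fin n → ℝ≥0∞)
    (π : CondDist S A) : Prop :=
  IsMinOn (empSEL D R) Set.univ π

/-! The teacher has zero loss, and sampled labels almost surely have positive teacher probability,
so a minimizer agrees with the teacher on every observed pair. Both being probability distributions,
their total variation at `s` is at most the teacher's mass on the labels unseen with `s`. Averaged
over `ρ`, the risk is thus at most the missing mass of `n` draws from a law on `k = |S||A|` points.
In expectation a point of mass `p` contributes at most `p * exp (-n p) ≤ 1 / n`. For the tail, the
exponential moment at `n / 2` is at most `2 ^ k`, and Chernoff gives the radius `(2 k + 2 log (1 /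
δ)) / n`, which both stated radii dominate up to a constant. -/

/-! ### Missing mass of an i.i.d. sample -/

section MissingMass

variable {X : Type*} [Fintype X] {n : ℕ}

open Classical in
/-- The total mass of the points that do not occur in the sample `D`. -/
noncomputable def missingMass (p : PMF X) (D : Fin n → X) : ℝ :=
  ∑ x, if ∀ i, D i ≠ x then (p x).toReal else 0

theorem PMF.sum_toReal_eq_one (p : PMF X) : ∑ x, (p x).toReal = 1 := by
  rw [← ENNReal.toReal_sum fun x _ => p.apply_ne_top x, ← tsum_fintype (L := .unconditional X), p.tsum_coe,
    ENNReal.toReal_one]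

variable [MeasurableSpace X] [DiscreteMeasurableSpace X]

/-- The law of `n` independent draws from `p`. -/
noncomputable abbrev sampleLaw (p : PMF X) (n : ℕ) : Measure (Fin n → X) :=
  Measure.pi fun _ => p.toMeasure

theorem measurable_of_sample {β : Type*} [MeasurableSpace β] (f : (Fin n → X) → β) :
    Measurable f :=
  measurable_of_finite f

theorem integrable_of_sample (p : PMF X) (f : (Fin n → X) → ℝ) :
    Integrable f (sampleLaw p n) :=
  Integrable.of_finite

/-- The probability is `(1 - p(T)) ^ n ≤ exp (-n p(T))`. The product form bounds joint unseen events
as if they were independent. -/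
theorem sampleLaw_real_avoid_le (p : PMF X) (T : Finset X) :
    (sampleLaw p n).real {D | ∀ i, D i ∉ T} ≤ ∏ x ∈ T, Real.exp (-(n * (p x).toReal)) := by
  have hset : {D : Fin n → X | ∀ i, D i ∉ T} = Set.univ.pi fun _ => (T : Set X)ᶜ := by
    ext D; simp
  have hT : p.toMeasure.real (T : Set X) = ∑ x ∈ T, (p x).toReal := by
    rw [Measure.real, PMF.toMeasure_apply_finset, ENNReal.toReal_sum fun x _ => p.apply_ne_top x]
  have hc : p.toMeasure.real (T : Set X)ᶜ = 1 - ∑ x ∈ T, (p x).toReal := by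
    rw [probReal_compl_eq_one_sub (MeasurableSet.of_discrete), hT]
  rw [hset, Measure.real, Measure.pi_pi, ENNReal.toReal_prod]
  simp only [← Measure.real_def, hc, Finset.prod_const, Finset.card_univ, Fintype.card_fin]
  rw [← Real.exp_sum, Finset.sum_neg_distrib, ← Finset.mul_sum, ← mul_neg, Real.exp_nat_mul]
  refine pow_le_pow_left₀ (hc ▸ measureReal_nonneg) ?_ n
  linarith [Real.add_one_le_exp (-∑ x ∈ T, (p x).toReal)]

theorem integral_missingMass_le (p : PMF X) (hn : 0 < n) :
    ∫ D, missingMass p D ∂(sampleLaw p n) ≤ Fintype.card X / n := by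
  classical
  have hn' : (0 : ℝ) < n := by exact_mod_cast hn
  unfold missingMass
  rw [integral_finsetSum _ fun x _ => integrable_of_sample p _]
  calc _ ≤ ∑ _x : X, (1 / n : ℝ) := Finset.sum_le_sum fun x _ => ?_
    _ = _ := by simp [div_eq_mul_inv]
  have hset : MeasurableSet {D : Fin n → X | ∀ i, D i ≠ x} := Set.Finite.measurableSet
    (Set.toFinite _)
  have hi : (∫ D, (if ∀ i, D i ≠ x then (p x).toReal else 0) ∂(sampleLaw p n))
      = (sampleLaw p n).real {D | ∀ i, D i ≠ x} * (p x).toReal := by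
    rw [← smul_eq_mul, ← integral_indicator_const _ hset]
    exact integral_congr_ae (.of_forall fun D => by simp [Set.indicator_apply])
  have hle := sampleLaw_real_avoid_le (n := n) p {x}
  simp only [Finset.mem_singleton, Finset.prod_singleton] at hle
  rw [hi, le_div_iff₀ hn']
  have hq : (0 : ℝ) ≤ (p x).toReal := ENNReal.toReal_nonneg
  set t := (n : ℝ) * (p x).toReal
  calc _ = (sampleLaw p n).real {D | ∀ i, D i ≠ x} * t := by ring
    _ ≤ Real.exp (-t) * t := by gcongr
    _ ≤ Real.exp (-t) * Real.exp t := by gcongr; linarith [Real.add_one_le_exp t]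
    _ = 1 := by rw [← Real.exp_add]; simp

/-- Exponential moment of the missing mass: the events that points are unseen are negatively
correlated, so that the moment is at most that of an independent sum. -/
theorem mgf_missingMass_le (p : PMF X) :
    mgf (missingMass p) (sampleLaw p n) (n / 2) ≤ 2 ^ Fintype.card X := by
  classical
  -- With this increment, `exp (n / 2 * missingMass)` is a product of factors `1 + c x` over unseen
  -- `x`; expanding it indexes the moment by sets `T` of jointly unseen points.
  set c : X → ℝ := fun x => Real.exp (n / 2 * (p x).toReal) - 1 with hc
  have hc0 : ∀ x, 0 ≤ c x := fun x => by
    have : (0 : ℝ) ≤ n / 2 * (p x).toReal := by positivity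
    simp only [hc]; linarith [Real.add_one_le_exp ((n : ℝ) / 2 * (p x).toReal)]
  have hexp : ∀ D : Fin n → X, Real.exp (n / 2 * missingMass p D)
      = ∑ T : Finset X, if ∀ i, D i ∉ T then ∏ x ∈ T, c x else 0 := by
    intro D
    have h1 : Real.exp (n / 2 * missingMass p D)
        = ∏ x, (1 + if ∀ i, D i ≠ x then c x else 0) := by
      rw [missingMass, Finset.mul_sum, Real.exp_sum]
      refine Finset.prod_congr rfl fun x _ => ?_
      split_ifs <;> simp [hc]
    rw [h1, Finset.prod_one_add, Finset.powerset_univ]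
    refine Finset.sum_congr rfl fun T _ => ?_
    split_ifs with h
    · exact Finset.prod_congr rfl fun x hx => if_pos fun i (hi : D i = x) => h i (hi ▸ hx)
    · push Not at h
      obtain ⟨i, hi⟩ := h
      exact Finset.prod_eq_zero hi (if_neg fun h' => h' i rfl)
  have hterm : ∀ T : Finset X,
      (∫ D, (if ∀ i, D i ∉ T then ∏ x ∈ T, c x else 0) ∂(sampleLaw p n)) ≤ 1 := by
    intro T
    have hset : MeasurableSet {D : Fin n → X | ∀ i, D i ∉ T} := Set.Finite.measurableSet
      (Set.toFinite _)
    have hi : (∫ D, (if ∀ i, D i ∉ T then ∏ x ∈ T, c x else 0) ∂(sampleLaw p n))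
        = (sampleLaw p n).real {D | ∀ i, D i ∉ T} * ∏ x ∈ T, c x := by
      rw [← smul_eq_mul, ← integral_indicator_const _ hset]
      exact integral_congr_ae (.of_forall fun D => by simp [Set.indicator_apply])
    rw [hi]
    refine (mul_le_mul_of_nonneg_right (sampleLaw_real_avoid_le p T)
      (Finset.prod_nonneg fun x _ => hc0 x)).trans ?_
    rw [← Finset.prod_mul_distrib]
    refine Finset.prod_le_one (fun x _ => mul_nonneg (Real.exp_pos _).le (hc0 x)) fun x _ => ?_
    -- Each factor is at most `1` because `c x ≤ exp (n p x)`, so each of the `2 ^ |X|` sets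
    -- contributes at most `1`.
    have hq : (0 : ℝ) ≤ n * (p x).toReal := by positivity
    calc _ ≤ Real.exp (-(n * (p x).toReal)) * Real.exp (n * (p x).toReal) := by
          gcongr
          have : Real.exp (n / 2 * (p x).toReal) ≤ Real.exp (n * (p x).toReal) :=
            Real.exp_le_exp.2 (by linarith)
          simp only [hc]; linarith
      _ = 1 := by rw [← Real.exp_add]; simp
  unfold mgf
  simp_rw [hexp]
  rw [integral_finsetSum _ fun T _ => integrable_of_sample p _]
  refine (Finset.sum_le_sum fun T _ => hterm T).trans ?_
  simp

theorem sampleLaw_real_missingMass_le (p : PMF X) (hn : 0 < n) {δ b : ℝ} (hδ : 0 < δ)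
    (hb : (2 * Fintype.card X + 2 * Real.log (1 / δ)) / n ≤ b) :
    1 - δ ≤ (sampleLaw p n).real {D | missingMass p D ≤ b} := by
  have hn' : (0 : ℝ) < n := by exact_mod_cast hn
  have htail : (sampleLaw p n).real {D | b ≤ missingMass p D} ≤ δ := by
    refine (measure_ge_le_exp_mul_mgf b (t := n / 2) (by positivity)
      (integrable_of_sample p _)).trans ?_
    have h2 : (2 : ℝ) ^ Fintype.card X ≤ Real.exp (Fintype.card X) := by
      rw [← mul_one (Fintype.card X : ℝ), Real.exp_nat_mul]
      gcongr
      linarith [Real.add_one_le_exp 1]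
    -- The radius is chosen so that the Chernoff exponent cancels `2 ^ |X| ≤ exp |X|` and leaves
    -- `log δ`.
    have h3 : -(n / 2 : ℝ) * b ≤ -Fintype.card X + Real.log δ := by
      rw [div_le_iff₀ hn', one_div, Real.log_inv] at hb
      linarith
    calc _ ≤ Real.exp (-Fintype.card X + Real.log δ) * Real.exp (Fintype.card X) := by
          refine mul_le_mul (Real.exp_le_exp.2 h3) ((mgf_missingMass_le p).trans h2) mgf_nonneg
            (Real.exp_pos _).le
      _ = δ := by rw [← Real.exp_add, neg_add_cancel_comm, Real.exp_log hδ]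
  have hcompl : {D : Fin n → X | missingMass p D ≤ b}ᶜ ⊆ {D | b ≤ missingMass p D} :=
    fun D hD => (lt_of_not_ge (by simpa using hD)).le
  have := probReal_compl_eq_one_sub (μ := sampleLaw p n)
    (s := {D : Fin n → X | missingMass p D ≤ b}) (Set.Finite.measurableSet (Set.toFinite _))
  have := measureReal_mono (μ := sampleLaw p n) hcompl
  linarith

end MissingMass

/-! ### From loss minimizers to missing mass -/

section Student

variable {S A : Type*} {n : ℕ}

theorem jointLaw_apply (ρ : PMF S) (π : CondDist S A) (s : S) (a : A) :
    jointLaw ρ π (s, a) = ρ s * π s a := by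
  classical
  rw [jointLaw, PMF.bind_apply, tsum_eq_single s]
  · congr 1
    rw [PMF.map_apply, tsum_eq_single a]
    · simp
    · intro b hb
      simp [hb.symm]
  · intro t ht
    rw [PMF.map_apply]
    simp [ht.symm]

theorem EReal.zero_le_sq (x : EReal) : 0 ≤ x ^ 2 := by
  rw [sq]
  rcases le_total 0 x with h | h
  · exact mul_nonneg h h
  · rw [← neg_mul_neg]
    have := EReal.neg_nonneg.2 h
    exact mul_nonneg this this

/-- The zero training loss of the teacher forces a minimizer to interpolate the soft labels. -/
theorem IsEmpSELMinimizer.apply_eq {D : Fin n → S × A} {πstar π : CondDist S A}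
    (h : IsEmpSELMinimizer D (softLabels πstar D) π)
    (h0 : ∀ i, πstar (D i).1 (D i).2 ≠ 0) (i : Fin n) :
    π (D i).1 (D i).2 = πstar (D i).1 (D i).2 := by
  have hbot : ∀ i, ENNReal.log (πstar (D i).1 (D i).2) ≠ ⊥ := fun i => by
    simpa [ENNReal.log_eq_bot_iff] using h0 i
  have htop : ∀ i, ENNReal.log (πstar (D i).1 (D i).2) ≠ ⊤ := fun i => by
    simpa [ENNReal.log_eq_top_iff] using (πstar (D i).1).apply_ne_top (D i).2
  have hstar : empSEL D (softLabels πstar D) πstar = 0 := by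
    refine Finset.sum_eq_zero fun i _ => ?_
    rw [softLabels, EReal.sub_self (htop i) (hbot i)]
    simp
  have hle : empSEL D (softLabels πstar D) π ≤ 0 := hstar ▸ h (Set.mem_univ πstar)
  have hnn : ∀ i ∈ Finset.univ, (0 : EReal) ≤ ((1 / 2 : ℝ) : EReal) *
      (ENNReal.log (π (D i).1 (D i).2) - ENNReal.log (softLabels πstar D i)) ^ 2 := fun i _ =>
    mul_nonneg (by exact_mod_cast (by norm_num : (0 : ℝ) ≤ 1 / 2)) (EReal.zero_le_sq _)
  have hz := (Finset.sum_eq_zero_iff_of_nonneg hnn).1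
    (le_antisymm hle (Finset.sum_nonneg hnn)) i (Finset.mem_univ i)
  have hhalf : ((1 / 2 : ℝ) : EReal) ≠ 0 := by exact_mod_cast (by norm_num : (1 / 2 : ℝ) ≠ 0)
  have hsub := pow_eq_zero_iff (two_ne_zero) |>.1 ((mul_eq_zero.1 hz).resolve_left hhalf)
  refine ENNReal.log_injective ?_
  simp only [softLabels] at hsub
  have hb := hbot i
  have ht := htop i
  generalize ENNReal.log (πstar (D i).1 (D i).2) = y at *
  generalize ENNReal.log (π (D i).1 (D i).2) = x at *
  lift y to ℝ using ⟨ht, hb⟩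
  -- The teacher's logarithm is finite, so an infinite student logarithm would make the difference
  -- infinite.
  induction x with
  | bot => simp at hsub
  | top => simp at hsub
  | coe x =>
    have : x - y = 0 := by exact_mod_cast hsub
    exact_mod_cast sub_eq_zero.1 this

theorem tvDist_nonneg [Fintype A] (p q : PMF A) : 0 ≤ tvDist p q :=
  mul_nonneg (by norm_num) (Finset.sum_nonneg fun _ _ => abs_nonneg _)

theorem condTV_nonneg [Fintype S] [Fintype A] (ρ : PMF S) (π π' : CondDist S A) :
    0 ≤ condTV ρ π π' :=
  Finset.sum_nonneg fun _ _ => mul_nonneg ENNReal.toReal_nonneg (tvDist_nonneg _ _)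

/-- If `p` and `q` agree where `P` fails, then they differ by at most the `q`-mass of `P`. -/
theorem tvDist_le_sum_of_eq [Fintype A] {p q : PMF A} {P : A → Prop} [DecidablePred P]
    (h : ∀ a, ¬ P a → p a = q a) :
    tvDist p q ≤ ∑ a, if P a then (q a).toReal else 0 := by
  -- The added signed difference sums to zero over `a`, so only the `q`-mass of `P` survives.
  have hterm : ∀ a, |(p a).toReal - (q a).toReal| ≤
      ((p a).toReal - (q a).toReal) + 2 * (if P a then (q a).toReal else 0) := by
    intro a
    have hp : 0 ≤ (p a).toReal := ENNReal.toReal_nonneg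
    have hq : 0 ≤ (q a).toReal := ENNReal.toReal_nonneg
    split_ifs with ha
    · rw [abs_le]; constructor <;> linarith
    · simp [h a ha]
  have := Finset.sum_le_sum fun a (_ : a ∈ Finset.univ) => hterm a
  rw [Finset.sum_add_distrib, Finset.sum_sub_distrib, p.sum_toReal_eq_one, q.sum_toReal_eq_one,
    ← Finset.mul_sum] at this
  unfold tvDist
  linarith

theorem condTV_le_missingMass [Fintype S] [Fintype A] (ρ : PMF S) {π πstar : CondDist S A}
    {D : Fin n → S × A} (h : ∀ i, π (D i).1 (D i).2 = πstar (D i).1 (D i).2) :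
    condTV ρ π πstar ≤ missingMass (jointLaw ρ πstar) D := by
  classical
  rw [missingMass, Fintype.sum_prod_type, condTV]
  refine Finset.sum_le_sum fun s _ => ?_
  refine (mul_le_mul_of_nonneg_left (tvDist_le_sum_of_eq (P := fun a => ∀ i, D i ≠ (s, a))
    fun a ha => ?_) ENNReal.toReal_nonneg).trans_eq ?_
  · push Not at ha
    obtain ⟨i, hi⟩ := ha
    simpa [hi] using h i
  · rw [Finset.mul_sum]
    refine Finset.sum_congr rfl fun a _ => ?_
    split_ifs <;> simp [jointLaw_apply]

variable [Fintype S] [Fintype A] [MeasurableSpace S] [DiscreteMeasurableSpace S]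
  [MeasurableSpace A] [DiscreteMeasurableSpace A]

/-- At a label of teacher probability zero, `⊥ - ⊥ = ⊥` in `EReal`, and the teacher's own loss would
be infinite. -/
theorem ae_datasetLaw_ne_zero (ρ : PMF S) (πstar : CondDist S A) :
    ∀ᵐ D ∂(datasetLaw ρ πstar n), ∀ i, πstar (D i).1 (D i).2 ≠ 0 := by
  refine ae_all_iff.2 fun i => ?_
  have hae : ∀ᵐ x ∂(jointLaw ρ πstar).toMeasure, πstar x.1 x.2 ≠ 0 := by
    rw [ae_iff, PMF.toMeasure_apply_eq_zero_iff _ MeasurableSet.of_discrete,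
      Set.disjoint_left]
    rintro ⟨s, a⟩ hx h0
    rw [PMF.mem_support_iff, jointLaw_apply] at hx
    exact hx (by simp [not_not.1 h0])
  exact (measurePreserving_eval (fun _ : Fin n => (jointLaw ρ πstar).toMeasure)
    i).quasiMeasurePreserving.ae hae

theorem ae_condTV_le_missingMass {Ω : Type*} [MeasurableSpace Ω] {μ : Measure Ω}
    {ρ : PMF S} {πstar : CondDist S A} {D : Ω → Fin n → S × A}
    (hD : HasLaw D (datasetLaw ρ πstar n) μ) {πhat : Ω → CondDist S A}
    (hmin : ∀ᵐ ω ∂μ, IsEmpSELMinimizer (D ω) (softLabels πstar (D ω)) (πhat ω)) :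
    ∀ᵐ ω ∂μ, condTV ρ (πhat ω) πstar ≤ missingMass (jointLaw ρ πstar) (D ω) := by
  have h0 : ∀ᵐ ω ∂μ, ∀ i, πstar (D ω i).1 (D ω i).2 ≠ 0 :=
    ae_of_ae_map hD.aemeasurable (hD.map_eq ▸ ae_datasetLaw_ne_zero ρ πstar)
  filter_upwards [hmin, h0] with ω hω h0ω
  exact condTV_le_missingMass ρ (hω.apply_eq h0ω)

theorem condTV_highProbability {Ω : Type*} [MeasurableSpace Ω] {μ : Measure Ω}
    [IsProbabilityMeasure μ] {ρ : PMF S} {πstar : CondDist S A} (hn : 0 < n)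
    {D : Ω → Fin n → S × A}
    (hD : HasLaw D (datasetLaw ρ πstar n) μ) {πhat : Ω → CondDist S A}
    (hmin : ∀ᵐ ω ∂μ, IsEmpSELMinimizer (D ω) (softLabels πstar (D ω)) (πhat ω))
    {δ b : ℝ} (hδ : 0 < δ)
    (hb : (2 * (Fintype.card S * Fintype.card A) + 2 * Real.log (1 / δ)) / n ≤ b) :
    1 - δ ≤ μ.real {ω | condTV ρ (πhat ω) πstar ≤ b} := by
  have h1 := sampleLaw_real_missingMass_le (jointLaw ρ πstar) hn hδ (b := b)
    (by simpa [Fintype.card_prod] using hb)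
  have hpre : (sampleLaw (jointLaw ρ πstar) n).real {D | missingMass (jointLaw ρ πstar) D ≤ b}
      = μ.real {ω | missingMass (jointLaw ρ πstar) (D ω) ≤ b} := by
    have hm := hD.map_eq
    rw [datasetLaw] at hm
    rw [sampleLaw, ← hm, Measure.real, Measure.map_apply_of_aemeasurable hD.aemeasurable
      (Set.Finite.measurableSet (Set.toFinite _))]
    rfl
  rw [hpre] at h1
  -- The risk event need not be measurable; almost-everywhere inclusion suffices.
  refine h1.trans (ENNReal.toReal_mono (measure_ne_top _ _) (measure_mono_ae ?_))
  filter_upwards [ae_condTV_le_missingMass hD hmin] with ω hω hM using hω.trans hM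

theorem condTV_expectedRisk {Ω : Type*} [MeasurableSpace Ω] {μ : Measure Ω}
    {ρ : PMF S} {πstar : CondDist S A} (hn : 0 < n)
    {D : Ω → Fin n → S × A}
    (hD : HasLaw D (datasetLaw ρ πstar n) μ) {πhat : Ω → CondDist S A}
    (hmeas : ∀ s a, AEMeasurable (fun ω => πhat ω s a) μ)
    (hmin : ∀ᵐ ω ∂μ, IsEmpSELMinimizer (D ω) (softLabels πstar (D ω)) (πhat ω)) :
    Integrable (fun ω => condTV ρ (πhat ω) πstar) μ ∧
      ∫ ω, condTV ρ (πhat ω) πstar ∂μ ≤ Fintype.card S * Fintype.card A / n := by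
  have hm : μ.map D = sampleLaw (jointLaw ρ πstar) n := hD.map_eq
  have hle := ae_condTV_le_missingMass hD hmin
  have hsm := (measurable_of_sample (missingMass (n := n) (jointLaw ρ πstar))).aestronglyMeasurable
    (μ := μ.map D)
  have hint : Integrable (fun ω => missingMass (jointLaw ρ πstar) (D ω)) μ :=
    (integrable_map_measure hsm hD.aemeasurable).1 (hm ▸ integrable_of_sample _ _)
  have hmeas' : AEMeasurable (fun ω => condTV ρ (πhat ω) πstar) μ := by
    unfold condTV tvDist
    refine Finset.aemeasurable_fun_sum _ fun s _ => AEMeasurable.const_mul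
      (AEMeasurable.const_mul (Finset.aemeasurable_fun_sum _ fun a _ => ?_) _) _
    exact continuous_abs.measurable.comp_aemeasurable ((hmeas s a).ennreal_toReal.sub_const _)
  have hI : Integrable (fun ω => condTV ρ (πhat ω) πstar) μ := by
    refine hint.mono' hmeas'.aestronglyMeasurable ?_
    filter_upwards [hle] with ω hω
    rwa [Real.norm_of_nonneg (condTV_nonneg _ _ _)]
  refine ⟨hI, (integral_mono_ae hI hint hle).trans ?_⟩
  rw [← integral_map hD.aemeasurable hsm, hm]
  simpa [Fintype.card_prod] using integral_missingMass_le (jointLaw ρ πstar) hn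

end Student

/-! ### Numerical comparisons and the theorem -/

theorem half_le_log_two : (1 / 2 : ℝ) ≤ Real.log 2 := by
  linarith [Real.log_two_gt_d9]

theorem half_le_log_div {N δ : ℝ} (hN : 2 ≤ N) (hδ : 0 < δ) (hδ1 : δ < 1) :
    1 / 2 ≤ Real.log (N / δ) := by
  refine half_le_log_two.trans (Real.log_le_log (by norm_num) ?_)
  rw [le_div_iff₀ hδ]
  nlinarith

theorem one_le_log_one_div {δ : ℝ} (hδ : 0 < δ) (hδ1 : δ ≤ 1 / 10) : 1 ≤ Real.log (1 / δ) := by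
  rw [Real.le_log_iff_exp_le (by positivity), le_div_iff₀ hδ]
  nlinarith [Real.exp_one_lt_d9]

/-- One numerical constant `C` serves all clauses. The student `πhat` is any random element of
`Δ(A | S)`, possibly with randomness of its own, that almost surely minimizes the empirical loss. -/
theorem theorem5 :
    ∃ C : ℝ, 0 < C ∧
      (∀ (S A Ω : Type*) [Fintype S] [Fintype A]
        [MeasurableSpace S] [DiscreteMeasurableSpace S]
        [MeasurableSpace A] [DiscreteMeasurableSpace A]
        [MeasurableSpace Ω] (μ : Measure Ω) [IsProbabilityMeasure μ]
        (ρ : PMF S) (πstar : CondDist S A) (n : ℕ) (_ : 0 < n)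
        (D : Ω → Fin n → S × A) (_ : HasLaw D (datasetLaw ρ πstar n) μ)
        (πhat : Ω → CondDist S A) (_ : ∀ s a, AEMeasurable (fun ω => πhat ω s a) μ)
        (_ : ∀ᵐ ω ∂μ, IsEmpSELMinimizer (D ω) (softLabels πstar (D ω)) (πhat ω)),
        -- high-probability bound for more than one input
        (1 < Fintype.card S →
          ∀ δ : ℝ, 0 < δ → δ < min 1 (((Fintype.card S : ℝ) + 2) / 10) →
            1 - δ ≤ μ.real {ω | condTV ρ (πhat ω) πstar ≤
              C * ((Fintype.card S : ℝ) * ((Fintype.card A : ℝ) +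
                    √((Fintype.card A : ℝ) * Real.log ((Fintype.card S : ℝ) / δ))) / (n : ℝ) *
                  Real.log ((Fintype.card S : ℝ) / δ))}) ∧
        -- high-probability bound for a single input
        (Fintype.card S = 1 →
          (∀ ω s, condTV ρ (πhat ω) πstar = tvDist (πhat ω s) (πstar s)) ∧
          ∀ δ : ℝ, 0 < δ → δ ≤ 1 / 10 →
            1 - δ ≤ μ.real {ω | condTV ρ (πhat ω) πstar ≤
              C * ((Fintype.card A : ℝ) / (n : ℝ) +
                  √(Fintype.card A : ℝ) / (n : ℝ) * Real.log (1 / δ))}) ∧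
        -- bound on the expected risk
        (Integrable (fun ω => condTV ρ (πhat ω) πstar) μ ∧
          ∫ ω, condTV ρ (πhat ω) πstar ∂μ ≤
            C * ((Fintype.card S : ℝ) * (Fintype.card A : ℝ) / (n : ℝ)))) ∧
      -- the expected-risk rate improves on the two radii by logarithmic factors at most
      (∀ (S A n : ℕ), 1 < S → 0 < A → 0 < n →
        ∀ δ : ℝ, 0 < δ → δ < min 1 (((S : ℝ) + 2) / 10) →
          (S : ℝ) * ((A : ℝ) + √((A : ℝ) * Real.log ((S : ℝ) / δ))) / (n : ℝ) *
              Real.log ((S : ℝ) / δ) ≤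
            C * ((S : ℝ) * (A : ℝ) / (n : ℝ) * Real.log ((S : ℝ) / δ) ^ 2)) ∧
      (∀ (A n : ℕ), 0 < A → 0 < n → ∀ δ : ℝ, 0 < δ → δ ≤ 1 / 10 →
          (A : ℝ) / (n : ℝ) + √(A : ℝ) / (n : ℝ) * Real.log (1 / δ) ≤
            C * ((A : ℝ) / (n : ℝ) * Real.log (1 / δ))) := by
  -- The estimates below need at most `6`, `2`, `1`, `4` and `2` respectively.
  refine ⟨8, by norm_num, ?_, ?_, ?_⟩
  · intro S A Ω _ _ _ _ _ _ _ μ _ ρ πstar n hn D hD πhat hmeas hmin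
    have hn' : (0 : ℝ) < n := by exact_mod_cast hn
    have hA : (1 : ℝ) ≤ Fintype.card A := by
      obtain ⟨s, -⟩ := ρ.support_nonempty
      obtain ⟨a, -⟩ := (πstar s).support_nonempty
      exact_mod_cast Fintype.card_pos_iff.2 ⟨a⟩
    refine ⟨fun hS δ hδ hδ1 => condTV_highProbability hn hD hmin hδ ?_, fun hS => ⟨?_, ?_⟩, ?_⟩
    · have hS2 : (2 : ℝ) ≤ Fintype.card S := by exact_mod_cast hS
      have hδ' : δ < 1 := hδ1.trans_le (min_le_left _ _)
      have hL := half_le_log_div hS2 hδ hδ'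
      have hlog : Real.log (1 / δ) ≤ Real.log (Fintype.card S / δ) :=
        Real.log_le_log (by positivity) (by gcongr; linarith)
      have hr := Real.sqrt_nonneg ((Fintype.card A : ℝ) * Real.log (Fintype.card S / δ))
      generalize √((Fintype.card A : ℝ) * Real.log (Fintype.card S / δ)) = r at *
      generalize Real.log ((Fintype.card S : ℝ) / δ) = L at *
      generalize (Fintype.card S : ℝ) = N at *
      generalize (Fintype.card A : ℝ) = K at *
      have hNK : 1 ≤ N * K := by nlinarith
      have hNr : 0 ≤ N * r * L := by positivity
      -- The square-root term is not needed: `2NK + 2L ≤ 6NKL`, using `L ≥ 1/2` and `NK ≥ 1`.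
      have h1 : N * K * (1 / 2) ≤ N * K * L := by gcongr
      have h2 : 1 * L ≤ N * K * L := by gcongr
      calc _ ≤ 8 * (N * (K + r) * L) / n := by gcongr; linarith
        _ = _ := by ring
    · intro ω s
      have : Subsingleton S := Fintype.card_le_one_iff_subsingleton.1 hS.le
      have hρ := ρ.sum_toReal_eq_one
      rw [Fintype.sum_subsingleton _ s] at hρ
      rw [condTV, Fintype.sum_subsingleton _ s, hρ, one_mul]
    · intro δ hδ hδ1
      refine condTV_highProbability hn hD hmin hδ ?_
      have hL := one_le_log_one_div hδ hδ1
      have hr : 1 ≤ √(Fintype.card A : ℝ) := Real.one_le_sqrt.2 hA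
      rw [hS]
      have h2 : 1 * Real.log (1 / δ) ≤ √(Fintype.card A : ℝ) * Real.log (1 / δ) := by gcongr
      calc _ ≤ 8 * ((Fintype.card A : ℝ) + √(Fintype.card A : ℝ) * Real.log (1 / δ)) / n := by
            gcongr
            push_cast
            linarith
        _ = _ := by ring
    · obtain ⟨hI, hle⟩ := condTV_expectedRisk hn hD hmeas hmin
      refine ⟨hI, hle.trans ?_⟩
      have : (0 : ℝ) ≤ Fintype.card S * Fintype.card A / n := by positivity
      linarith
  · intro S A n hS hA hn δ hδ hδ1
    have hn' : (0 : ℝ) < n := by exact_mod_cast hn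
    have hA' : (1 : ℝ) ≤ A := by exact_mod_cast hA
    have hS2 : (2 : ℝ) ≤ S := by exact_mod_cast hS
    have hL := half_le_log_div hS2 hδ (hδ1.trans_le (min_le_left _ _))
    generalize Real.log ((S : ℝ) / δ) = L at *
    have hAL : 1 / 2 ≤ (A : ℝ) * L := by nlinarith
    -- `√x ≤ 2x` once `x ≥ 1/4`.
    have hr : √((A : ℝ) * L) ≤ 2 * (A * L) := by
      rw [Real.sqrt_le_left (by linarith)]
      nlinarith
    have hA2 : (A : ℝ) ≤ 2 * (A * L) := by nlinarith
    calc _ ≤ (S : ℝ) * (2 * (A * L) + 2 * (A * L)) / n * L := by gcongr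
      _ = 4 * (S * A / n * L ^ 2) := by ring
      _ ≤ _ := by gcongr; norm_num
  · intro A n hA hn δ hδ hδ1
    have hA' : (1 : ℝ) ≤ A := by exact_mod_cast hA
    have hL := one_le_log_one_div hδ hδ1
    generalize Real.log (1 / δ) = L at *
    have hr : √(A : ℝ) ≤ A := by
      rw [Real.sqrt_le_left (by linarith)]
      nlinarith
    have hA2 : (A : ℝ) * 1 ≤ A * L := by gcongr
    calc _ ≤ (A : ℝ) * L / n + A / n * L := by gcongr; linarith
      _ = 2 * (A / n * L) := by ring
      _ ≤ _ := by gcongr; norm_num
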